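/- Let $\alpha\in(0,1)$ and let $X$ be a totally asymmetric $\alpha$-stable random variable, that is, a real random variable with characteristic function $$\mathbb{E}\,e^{itX}=\exp\Big(\int_0^\infty (e^{itx}-1)\,\frac{dx}{x^{\alpha+1}}\Big),\qquad t\in\mathbb{R}.$$ Then for every $y\ge (1/\alpha)^{1/\alpha}$, $$\mathbb{P}\Big(X>\frac{1}{1-\alpha}+3y\Big)\le \frac{2}{\alpha y^{\alpha}}.$$ Moreover, for every $y\ge 1$ and every $\theta\in(0,1)$, $$\mathbb{P}\Big(X\ge \frac{\theta}{1-\alpha}+y\Big)\ge \frac{2}{3}(1-\theta)^2\,\frac{1}{1+\alpha y^{\alpha}}.$$ -/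

import Mathlib

open MeasureTheory

/-- The characteristic exponent `∫_0^∞ (e^{itx} - 1) x^{-α-1} dx` of the strictly `α`-stable law
with Lévy measure `x^{-α-1} 1_{(0,∞)}(x) dx`. The integral converges absolutely for `0 < α < 1`. -/
noncomputable def stableExponent (α t : ℝ) : ℂ :=
  ∫ x in Set.Ioi (0 : ℝ),
    (Complex.exp (Complex.I * (t : ℂ) * (x : ℂ)) - 1) * ((1 / x ^ (α + 1) : ℝ) : ℂ)

/-- `X` is a totally asymmetric `α`-stable random variable (for `0 < α < 1`): its characteristic
function is `t ↦ exp (∫_0^∞ (e^{itx} - 1) x^{-α-1} dx)`. -/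
structure IsTotallyAsymmetricStable {Ω : Type*} [MeasurableSpace Ω]
    (α : ℝ) (X : Ω → ℝ) (P : Measure Ω) : Prop where
  aemeasurable : AEMeasurable X P
  charFun_eq : ∀ t : ℝ, charFun (P.map X) t = Complex.exp (stableExponent α t)

/-! `X` is the sum of the jumps of a Poisson process with intensity `x^{-α-1} dx`. Cut the jumps at
a level `R`: the small and the large jumps give independent sums.

Upper tail, `R = y`: a large jump occurs with probability at most its mass `1/(α y^α)`. The small
sum has mean at most `1/(1-α) + y` and variance at most `y^{2-α}/(2-α)`, so Chebyshev bounds the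
other half (`conv_real_Ioi_le`).

Lower tail, `R = 1`: the small sum has limiting mean `1/(1-α)`, and Paley–Zygmund
(`sq_sub_div_le_measureReal_Ici`) keeps it above `θ/(1-α)`. Independently, some large jump reaches
`y` with probability at least `1 - exp(-1/(α y^α)) ≥ 1/(1 + α y^α)`.

No Poisson process is built: each sum is replaced by `n` i.i.d. thinned jumps. The bounds hold for
all `n ≥ 1/α`, up to the truncated mean in the lower tail; convergence of characteristic functions
and the portmanteau theorem carry them to `X`. -/

open Filter Topology ProbabilityTheory

/-! ### Sums of `n` i.i.d. thinned jumps. -/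

section BinomialLaw

/-- The law of a single summand: a jump distributed according to `Λ / n`, and otherwise `0`. -/
noncomputable def thinnedLaw (Λ : Measure ℝ) (n : ℕ) : Measure ℝ :=
  ENNReal.ofReal (1 - Λ.real Set.univ / n) • Measure.dirac 0 + ENNReal.ofReal (1 / n) • Λ

/-- The law of the sum of `n` independent variables with law `thinnedLaw Λ n`. For large `n` it
approximates the compound Poisson law with Lévy measure `Λ`. -/
noncomputable def binomialLaw (Λ : Measure ℝ) (n : ℕ) : Measure ℝ :=
  (Measure.pi fun _ : Fin n ↦ thinnedLaw Λ n).map fun x ↦ ∑ i, x i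

variable {Λ : Measure ℝ} {n : ℕ}

lemma one_sub_mass_div_nonneg (hn : 0 < n) (hΛ : Λ.real Set.univ ≤ n) :
    0 ≤ 1 - Λ.real Set.univ / n := by
  have : (0 : ℝ) < n := by exact_mod_cast hn
  rw [sub_nonneg, div_le_one this]
  exact hΛ

lemma memLp_thinnedLaw {f : ℝ → ℝ} (hf : MemLp f 2 Λ) (hf' : Measurable f) :
    MemLp f 2 (thinnedLaw Λ n) := by
  rw [memLp_two_iff_integrable_sq hf'.aestronglyMeasurable]
  exact ((integrable_dirac (by finiteness)).smul_measure ENNReal.ofReal_ne_top).add_measure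
    (hf.integrable_sq.smul_measure ENNReal.ofReal_ne_top)

lemma integral_thinnedLaw {E : Type*} [NormedAddCommGroup E] [NormedSpace ℝ E] [CompleteSpace E]
    (hn : 0 < n) (hΛ : Λ.real Set.univ ≤ n) {f : ℝ → E} (hf : Integrable f Λ) :
    ∫ x, f x ∂thinnedLaw Λ n
      = (1 - Λ.real Set.univ / n) • f 0 + (1 / n : ℝ) • ∫ x, f x ∂Λ := by
  have h1 := one_sub_mass_div_nonneg hn hΛ
  rw [thinnedLaw, integral_add_measure
    ((integrable_dirac (by finiteness)).smul_measure ENNReal.ofReal_ne_top)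
    (hf.smul_measure ENNReal.ofReal_ne_top), integral_smul_measure, integral_smul_measure,
    integral_dirac, ENNReal.toReal_ofReal h1, ENNReal.toReal_ofReal (by positivity)]

variable [IsFiniteMeasure Λ]

lemma thinnedLaw_real_apply (hn : 0 < n) (hΛ : Λ.real Set.univ ≤ n) (s : Set ℝ) :
    (thinnedLaw Λ n).real s
      = (1 - Λ.real Set.univ / n) * (Measure.dirac (0 : ℝ)).real s + Λ.real s / n := by
  have h1 := one_sub_mass_div_nonneg hn hΛ
  rw [thinnedLaw, measureReal_add_apply
      (ENNReal.mul_ne_top ENNReal.ofReal_ne_top (measure_ne_top _ _))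
      (ENNReal.mul_ne_top ENNReal.ofReal_ne_top (measure_ne_top _ _)),
    measureReal_ennreal_smul_apply,
    measureReal_ennreal_smul_apply, ENNReal.toReal_ofReal h1,
    ENNReal.toReal_ofReal (by positivity)]
  ring

lemma isProbabilityMeasure_thinnedLaw (hn : 0 < n) (hΛ : Λ.real Set.univ ≤ n) :
    IsProbabilityMeasure (thinnedLaw Λ n) := by
  have h := thinnedLaw_real_apply hn hΛ Set.univ
  simp only [probReal_univ] at h
  refine ⟨?_⟩
  have h1 : (thinnedLaw Λ n).real Set.univ = 1 := by rw [h]; ring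
  rwa [measureReal_def, ENNReal.toReal_eq_one_iff] at h1

lemma isProbabilityMeasure_binomialLaw (hn : 0 < n) (hΛ : Λ.real Set.univ ≤ n) :
    IsProbabilityMeasure (binomialLaw Λ n) := by
  have := isProbabilityMeasure_thinnedLaw hn hΛ
  exact Measure.isProbabilityMeasure_map (by fun_prop)

/-- The atom at `0` supplies the missing mass, which turns `exp` into `exp - 1` under the integral
against `Λ`. -/
lemma charFun_binomialLaw (hn : 0 < n) (hΛ : Λ.real Set.univ ≤ n) (t : ℝ) :
    charFun (binomialLaw Λ n) t
      = (1 + (∫ x, (Complex.exp (Complex.I * t * x) - 1) ∂Λ) / n) ^ n := by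
  have := isProbabilityMeasure_thinnedLaw hn hΛ
  have hint : Integrable (fun x : ℝ ↦ Complex.exp (t * x * Complex.I)) Λ := by
    refine Integrable.of_bound (by fun_prop) 1 (ae_of_all _ fun x ↦ ?_)
    exact_mod_cast (Complex.norm_exp_ofReal_mul_I (t * x)).le
  rw [binomialLaw, charFun_map_sum_pi_eq_prod]
  simp only [Finset.prod_const, Finset.card_univ, Fintype.card_fin, Pi.pow_apply]
  congr 1
  rw [charFun_apply_real, integral_thinnedLaw hn hΛ hint]
  have h2 : ∫ x : ℝ, (Complex.exp (Complex.I * t * x) - 1) ∂Λ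
      = (∫ x : ℝ, Complex.exp (t * x * Complex.I) ∂Λ) - Λ.real Set.univ := by
    rw [← integral_congr_ae (ae_of_all _ fun x ↦ by ring_nf :
      (fun x : ℝ ↦ Complex.exp (t * x * Complex.I) - 1)
        =ᵐ[Λ] fun x : ℝ ↦ Complex.exp (Complex.I * t * x) - 1),
      integral_sub hint (integrable_const _)]
    simp
  rw [h2]
  simp only [Complex.real_smul]
  push_cast
  simp
  ring

lemma memLp_binomialLaw (hn : 0 < n) (hΛ : Λ.real Set.univ ≤ n) (h2 : MemLp id 2 Λ) :
    MemLp id 2 (binomialLaw Λ n) := by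
  have := isProbabilityMeasure_thinnedLaw hn hΛ
  rw [binomialLaw, memLp_map_measure_iff (by fun_prop) (by fun_prop)]
  exact memLp_finsetSum Finset.univ fun i _ ↦
    (memLp_thinnedLaw h2 measurable_id).comp_measurePreserving
      (measurePreserving_eval (fun _ : Fin n ↦ thinnedLaw Λ n) i)

lemma integral_id_binomialLaw (hn : 0 < n) (hΛ : Λ.real Set.univ ≤ n) (h2 : MemLp id 2 Λ) :
    ∫ x, x ∂binomialLaw Λ n = ∫ x, x ∂Λ := by
  have := isProbabilityMeasure_thinnedLaw hn hΛ
  have hn' : (n : ℝ) ≠ 0 := by exact_mod_cast hn.ne'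
  have hint : Integrable (fun x : ℝ ↦ x) (thinnedLaw Λ n) :=
    (memLp_thinnedLaw h2 measurable_id).integrable (by norm_num)
  rw [binomialLaw, integral_map (by fun_prop) (by fun_prop), integral_finsetSum]
  · have h (i : Fin n) : ∫ x : Fin n → ℝ, x i ∂(Measure.pi fun _ ↦ thinnedLaw Λ n)
        = (∫ x, x ∂Λ) / n := by
      rw [integral_comp_eval (μ := fun _ : Fin n ↦ thinnedLaw Λ n) (f := fun x : ℝ ↦ x)
        (by fun_prop), integral_thinnedLaw hn hΛ (f := fun x ↦ x) (h2.integrable (by norm_num))]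
      simp
      ring
    simp only [h, Finset.sum_const, Finset.card_univ, Fintype.card_fin, nsmul_eq_mul]
    field_simp
  · exact fun i _ ↦ integrable_comp_eval (μ := fun _ : Fin n ↦ thinnedLaw Λ n) hint

lemma variance_binomialLaw_le (hn : 0 < n) (hΛ : Λ.real Set.univ ≤ n) (h2 : MemLp id 2 Λ) :
    Var[id; binomialLaw Λ n] ≤ ∫ x, x ^ 2 ∂Λ := by
  have := isProbabilityMeasure_thinnedLaw hn hΛ
  have hn' : (n : ℝ) ≠ 0 := by exact_mod_cast hn.ne'
  have h := variance_sum_pi (μ := fun _ : Fin n ↦ thinnedLaw Λ n) (X := fun _ ↦ id)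
    fun _ ↦ memLp_thinnedLaw h2 measurable_id
  have hsum : (∑ i : Fin n, fun ω : Fin n → ℝ ↦ id (ω i)) = fun x ↦ ∑ i, x i := by
    ext x; simp
  have hsingle : Var[id; thinnedLaw Λ n] ≤ (∫ x, x ^ 2 ∂Λ) / n := by
    refine (variance_le_expectation_sq (by fun_prop)).trans_eq ?_
    simp only [id, Pi.pow_apply]
    rw [integral_thinnedLaw hn hΛ (f := fun x ↦ x ^ 2) h2.integrable_sq]
    simp
    ring
  rw [binomialLaw, variance_map (by fun_prop) (by fun_prop), Function.id_comp, ← hsum, h]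
  calc ∑ _ : Fin n, Var[id; thinnedLaw Λ n] ≤ ∑ _ : Fin n, (∫ x, x ^ 2 ∂Λ) / n :=
        Finset.sum_le_sum fun _ _ ↦ hsingle
    _ = ∫ x, x ^ 2 ∂Λ := by
        simp only [Finset.sum_const, Finset.card_univ, Fintype.card_fin, nsmul_eq_mul]
        field_simp

/-- Union bound: each of the `n` summands is nonzero with probability at most `Λ(ℝ)/n`. -/
lemma binomialLaw_real_compl_zero_le (hn : 0 < n) (hΛ : Λ.real Set.univ ≤ n) :
    (binomialLaw Λ n).real {0}ᶜ ≤ Λ.real Set.univ := by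
  have := isProbabilityMeasure_thinnedLaw hn hΛ
  have hn' : (n : ℝ) ≠ 0 := by exact_mod_cast hn.ne'
  have hsub : (fun x : Fin n → ℝ ↦ ∑ i, x i) ⁻¹' {0}ᶜ ⊆ ⋃ i, Function.eval i ⁻¹' {0}ᶜ := by
    intro x hx
    by_contra! hc
    simp only [Set.mem_iUnion, not_exists, Set.mem_preimage, Set.mem_compl_iff,
      Set.mem_singleton_iff, not_not, Function.eval] at hc hx
    exact hx (Finset.sum_eq_zero fun i _ ↦ hc i)
  have hsingle (i : Fin n) :
      (Measure.pi fun _ : Fin n ↦ thinnedLaw Λ n).real (Function.eval i ⁻¹' {0}ᶜ)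
        ≤ Λ.real Set.univ / n := by
    rw [(measurePreserving_eval (fun _ : Fin n ↦ thinnedLaw Λ n) i).measureReal_preimage
      (by measurability), thinnedLaw_real_apply hn hΛ]
    have : (Measure.dirac (0 : ℝ)).real {0}ᶜ = 0 := by simp [measureReal_def]
    rw [this, mul_zero, zero_add]
    gcongr
    · finiteness
    · exact Set.subset_univ _
  rw [binomialLaw, map_measureReal_apply (by fun_prop) (by measurability)]
  calc _ ≤ _ := measureReal_mono hsub
    _ ≤ ∑ i, _ := measureReal_iUnion_fintype_le _
    _ ≤ ∑ _ : Fin n, Λ.real Set.univ / n := Finset.sum_le_sum fun i _ ↦ hsingle i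
    _ = Λ.real Set.univ := by
        simp only [Finset.sum_const, Finset.card_univ, Fintype.card_fin, nsmul_eq_mul]
        field_simp

lemma ae_nonneg_pi_thinnedLaw (hn : 0 < n) (hΛ : Λ.real Set.univ ≤ n) (h0 : ∀ᵐ x ∂Λ, 0 ≤ x) :
    ∀ᵐ x ∂(Measure.pi fun _ : Fin n ↦ thinnedLaw Λ n), ∀ i, 0 ≤ x i := by
  have := isProbabilityMeasure_thinnedLaw hn hΛ
  have h : ∀ᵐ x ∂thinnedLaw Λ n, 0 ≤ x := by
    rw [thinnedLaw, ae_add_measure_iff]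
    refine ⟨Measure.ae_smul_measure ?_ _, Measure.ae_smul_measure h0 _⟩
    exact (ae_dirac_iff measurableSet_Ici).2 le_rfl
  rw [ae_all_iff]
  exact fun i ↦
    (measurePreserving_eval (fun _ : Fin n ↦ thinnedLaw Λ n) i).quasiMeasurePreserving.ae h

lemma ae_nonneg_binomialLaw (hn : 0 < n) (hΛ : Λ.real Set.univ ≤ n) (h0 : ∀ᵐ x ∂Λ, 0 ≤ x) :
    ∀ᵐ x ∂binomialLaw Λ n, 0 ≤ x := by
  rw [binomialLaw, ae_map_iff (by fun_prop) measurableSet_Ici]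
  filter_upwards [ae_nonneg_pi_thinnedLaw hn hΛ h0] with x hx
  exact Finset.sum_nonneg fun i _ ↦ hx i

/-- The sum exceeds `y` as soon as one of the jumps does. -/
lemma one_sub_exp_le_binomialLaw_real_Ici (hn : 0 < n) (hΛ : Λ.real Set.univ ≤ n)
    (h0 : ∀ᵐ x ∂Λ, 0 ≤ x) {y : ℝ} (hy : 0 < y) :
    1 - Real.exp (-Λ.real (Set.Ici y)) ≤ (binomialLaw Λ n).real (Set.Ici y) := by
  have := isProbabilityMeasure_thinnedLaw hn hΛ
  have := isProbabilityMeasure_binomialLaw hn hΛ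
  have hsingle : (thinnedLaw Λ n).real (Set.Iio y) = 1 - Λ.real (Set.Ici y) / n := by
    rw [← Set.compl_Ici, probReal_compl_eq_one_sub measurableSet_Ici,
      thinnedLaw_real_apply hn hΛ]
    have : (Measure.dirac (0 : ℝ)).real (Set.Ici y) = 0 := by
      simp [measureReal_def, hy]
    rw [this]
    ring
  have hle : (binomialLaw Λ n).real (Set.Iio y) ≤ Real.exp (-Λ.real (Set.Ici y)) := by
    rw [binomialLaw, map_measureReal_apply (by fun_prop) measurableSet_Iio]
    calc _ ≤ (Measure.pi fun _ : Fin n ↦ thinnedLaw Λ n).real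
            (Set.univ.pi fun _ ↦ Set.Iio y) := by
          refine ENNReal.toReal_mono (by finiteness) (measure_mono_ae ?_)
          filter_upwards [ae_nonneg_pi_thinnedLaw hn hΛ h0] with x hx hs i _
          exact (Finset.single_le_sum (fun j _ ↦ hx j) (Finset.mem_univ i)).trans_lt hs
      _ = (1 - Λ.real (Set.Ici y) / n) ^ n := by
          rw [measureReal_def, Measure.pi_pi, ENNReal.toReal_prod]
          change ∏ _ : Fin n, (thinnedLaw Λ n).real (Set.Iio y) = _
          simp [hsingle]
      _ ≤ _ := Real.one_sub_div_pow_le_exp_neg ((measureReal_mono (Set.subset_univ _)).trans hΛ)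
  rw [← Set.compl_Ici, probReal_compl_eq_one_sub measurableSet_Ici] at hle
  linarith

end BinomialLaw

/-- A form of the **Paley–Zygmund inequality**. -/
lemma sq_sub_div_le_measureReal_Ici {μ : Measure ℝ} [IsProbabilityMeasure μ] (h2 : MemLp id 2 μ)
    (h0 : ∀ᵐ x ∂μ, 0 ≤ x) {a s : ℝ} (ha : 0 ≤ a) (ham : a < ∫ x, x ∂μ)
    (hs : ∫ x, x ^ 2 ∂μ ≤ s) (hs0 : 0 < s) :
    (∫ x, x ∂μ - a) ^ 2 / s ≤ μ.real (Set.Ici a) := by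
  set m := ∫ x, x ∂μ with hm
  have hint : Integrable (fun x : ℝ ↦ x) μ := h2.integrable (by norm_num)
  have hsq : Integrable (fun x : ℝ ↦ x ^ 2) μ := h2.integrable_sq
  -- Integrating `x - a ≤ c x²/2 + 1_{x ≥ a}/(2c)` (AM-GM when `x ≥ a`) gives `P(x ≥ a) ≥ 2c(m - a)
  -- - c² s`; this `c` maximises the right side.
  set c := (m - a) / s with hc
  have hcpos : 0 < c := div_pos (by linarith) hs0
  have hind : Integrable (fun x ↦ (Set.Ici a).indicator (fun _ : ℝ ↦ (1 : ℝ)) x) μ :=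
    (integrable_const _).indicator measurableSet_Ici
  have key : ∫ x, (x - a) ∂μ
      ≤ ∫ x, (c / 2 * x ^ 2 + 1 / (2 * c) * (Set.Ici a).indicator (fun _ ↦ (1 : ℝ)) x) ∂μ := by
    refine integral_mono_ae (hint.sub (integrable_const _))
      ((hsq.const_mul _).add (hind.const_mul _)) ?_
    filter_upwards [h0] with x hx
    by_cases hxa : a ≤ x
    · rw [Set.indicator_of_mem (by exact hxa)]
      have : c / 2 * x ^ 2 + 1 / (2 * c) * 1 - x = (c * x - 1) ^ 2 / (2 * c) := by
        field_simp
        ring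
      have : 0 ≤ (c * x - 1) ^ 2 / (2 * c) := by positivity
      linarith
    · rw [Set.indicator_of_notMem (by exact hxa)]
      have : 0 ≤ c / 2 * x ^ 2 := by positivity
      linarith [not_le.mp hxa]
  rw [integral_sub hint (integrable_const _), integral_add (hsq.const_mul _) (hind.const_mul _),
    integral_const_mul, integral_const_mul, integral_indicator_const _ measurableSet_Ici] at key
  simp only [integral_const, probReal_univ, smul_eq_mul, one_mul, mul_one] at key
  have h3 : m - a ≤ c / 2 * s + 1 / (2 * c) * μ.real (Set.Ici a) :=
    key.trans (by gcongr)
  have h4 : c / 2 * s = (m - a) / 2 := by rw [hc]; field_simp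
  rw [h4] at h3
  have h5 : (m - a) * c ≤ μ.real (Set.Ici a) := by
    have : (m - a) / 2 ≤ μ.real (Set.Ici a) / (2 * c) := by
      rw [div_eq_inv_mul (μ.real _), ← one_div]; linarith
    rw [div_le_div_iff₀ two_pos (by positivity)] at this
    linarith
  calc (m - a) ^ 2 / s = (m - a) * c := by rw [hc]; ring
    _ ≤ _ := h5

/-! ### Truncations of the stable Lévy measure. -/

section StableLevy

/-- The restriction to `A` of the Lévy measure `x^{-α-1} dx`. -/
noncomputable def stableLevy (α : ℝ) (A : Set ℝ) : Measure ℝ :=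
  (volume.restrict A).withDensity fun x ↦ ENNReal.ofReal (1 / x ^ (α + 1))

variable {α : ℝ} {A : Set ℝ}

lemma integral_stableLevy {E : Type*} [NormedAddCommGroup E] [NormedSpace ℝ E]
    (hA : MeasurableSet A) (hA0 : A ⊆ Set.Ioi 0) (f : ℝ → E) :
    ∫ x, f x ∂stableLevy α A = ∫ x in A, (1 / x ^ (α + 1)) • f x := by
  rw [stableLevy, integral_withDensity_eq_integral_toReal_smul (by fun_prop)
    (ae_of_all _ fun _ ↦ ENNReal.ofReal_lt_top)]
  refine setIntegral_congr_fun hA fun x hx ↦ ?_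
  have hx0 : 0 < x := hA0 hx
  rw [ENNReal.toReal_ofReal (by positivity)]

lemma ae_mem_stableLevy (hA : MeasurableSet A) : ∀ᵐ x ∂stableLevy α A, x ∈ A :=
  (withDensity_absolutelyContinuous _ _).ae_le (ae_restrict_mem hA)

lemma ae_nonneg_stableLevy (hA : MeasurableSet A) (hA0 : A ⊆ Set.Ioi 0) :
    ∀ᵐ x ∂stableLevy α A, 0 ≤ x :=
  (ae_mem_stableLevy hA).mono fun _ hx ↦ (hA0 hx).le

lemma stableLevy_Ioi_univ (hα : 0 < α) {c : ℝ} (hc : 0 < c) :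
    stableLevy α (Set.Ioi c) Set.univ = ENNReal.ofReal (1 / (α * c ^ α)) := by
  have heq : Set.EqOn (fun x : ℝ ↦ x ^ (-(α + 1))) (fun x ↦ 1 / x ^ (α + 1)) (Set.Ioi c) :=
    fun x hx ↦ by
      simp only
      rw [Real.rpow_neg (hc.trans hx).le, one_div]
  have hint : IntegrableOn (fun x : ℝ ↦ 1 / x ^ (α + 1)) (Set.Ioi c) :=
    (integrableOn_Ioi_rpow_of_lt (by linarith) hc).congr_fun heq measurableSet_Ioi
  rw [stableLevy, withDensity_apply _ MeasurableSet.univ, Measure.restrict_univ,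
    ← ofReal_integral_eq_lintegral_ofReal hint, ← setIntegral_congr_fun measurableSet_Ioi heq,
    integral_Ioi_rpow_of_lt (by linarith) hc]
  · congr 1
    have : -(α + 1) + 1 = -α := by ring
    rw [this, Real.rpow_neg hc.le]
    field_simp
  · filter_upwards [ae_restrict_mem measurableSet_Ioi] with x hx
    have : 0 < x := hc.trans hx
    positivity

lemma stableLevy_real_Ioi_univ (hα : 0 < α) {c : ℝ} (hc : 0 < c) :
    (stableLevy α (Set.Ioi c)).real Set.univ = 1 / (α * c ^ α) := by
  rw [measureReal_def, stableLevy_Ioi_univ hα hc, ENNReal.toReal_ofReal (by positivity)]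

lemma stableLevy_mono {B : Set ℝ} (h : A ⊆ B) : stableLevy α A ≤ stableLevy α B := by
  refine Measure.le_iff.2 fun s hs ↦ ?_
  rw [stableLevy, stableLevy, withDensity_apply _ hs, withDensity_apply _ hs]
  exact lintegral_mono' (Measure.restrict_mono subset_rfl (Measure.restrict_mono h le_rfl)) le_rfl

lemma isFiniteMeasure_stableLevy (hα : 0 < α) {c : ℝ} (hc : 0 < c) (h : A ⊆ Set.Ioi c) :
    IsFiniteMeasure (stableLevy α A) := by
  refine ⟨((stableLevy_mono h) _).trans_lt ?_⟩
  rw [stableLevy_Ioi_univ hα hc]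
  exact ENNReal.ofReal_lt_top

lemma stableLevy_real_univ_le (hα : 0 < α) {c : ℝ} (hc : 0 < c) (h : A ⊆ Set.Ioi c) :
    (stableLevy α A).real Set.univ ≤ 1 / (α * c ^ α) := by
  rw [← stableLevy_real_Ioi_univ hα hc]
  have := isFiniteMeasure_stableLevy hα hc subset_rfl
  exact ENNReal.toReal_mono (by finiteness) (stableLevy_mono h _)

lemma le_stableLevy_real_Ici (hα : 0 < α) {c y : ℝ} (hc : 0 < c) (hcy : c ≤ y) :
    1 / (α * y ^ α) ≤ (stableLevy α (Set.Ioi c)).real (Set.Ici y) := by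
  have := isFiniteMeasure_stableLevy hα hc subset_rfl
  have hae : (stableLevy α (Set.Ioi y)) Set.univ ≤ stableLevy α (Set.Ioi y) (Set.Ici y) := by
    refine measure_mono_ae ?_
    filter_upwards [ae_mem_stableLevy measurableSet_Ioi] with x hx _
    exact hx.le
  rw [← stableLevy_real_Ioi_univ hα (hc.trans_le hcy)]
  exact ENNReal.toReal_mono (by finiteness)
    (hae.trans (stableLevy_mono (Set.Ioi_subset_Ioi hcy) _))

lemma memLp_id_stableLevy_Ioc (hα : 0 < α) {c R : ℝ} (hc : 0 < c) :
    MemLp id 2 (stableLevy α (Set.Ioc c R)) := by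
  have := isFiniteMeasure_stableLevy (A := Set.Ioc c R) hα hc Set.Ioc_subset_Ioi_self
  refine MemLp.of_bound (by fun_prop) R ?_
  filter_upwards [ae_mem_stableLevy measurableSet_Ioc] with x hx
  rw [id, Real.norm_of_nonneg (hc.trans hx.1).le]
  exact hx.2

lemma integrableOn_rpow_Ioc {p R : ℝ} (hp : -1 < p) (hR : 0 ≤ R) :
    IntegrableOn (fun x : ℝ ↦ x ^ p) (Set.Ioc 0 R) :=
  (intervalIntegrable_iff_integrableOn_Ioc_of_le hR).1
    (intervalIntegral.intervalIntegrable_rpow' hp)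

lemma integral_rpow_Ioc {p R : ℝ} (hp : -1 < p) (hR : 0 ≤ R) :
    ∫ x in Set.Ioc 0 R, x ^ p = R ^ (p + 1) / (p + 1) := by
  rw [← intervalIntegral.integral_of_le hR, integral_rpow (Or.inl hp),
    Real.zero_rpow (by linarith), sub_zero]

lemma integral_pow_stableLevy_Ioc {c R : ℝ} (hc : 0 < c) (k : ℕ) :
    ∫ x, x ^ k ∂stableLevy α (Set.Ioc c R) = ∫ x in Set.Ioc c R, x ^ (k - α - 1) := by
  rw [integral_stableLevy measurableSet_Ioc fun x hx ↦ hc.trans hx.1]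
  refine setIntegral_congr_fun measurableSet_Ioc fun x hx ↦ ?_
  have hx0 : 0 < x := hc.trans hx.1
  simp only [smul_eq_mul]
  rw [sub_sub, Real.rpow_sub hx0, Real.rpow_natCast]
  ring

lemma integral_pow_stableLevy_Ioc_le {c R : ℝ} (hc : 0 < c) (hR : 0 ≤ R) {k : ℕ} (hk : α < k) :
    ∫ x, x ^ k ∂stableLevy α (Set.Ioc c R) ≤ R ^ (k - α) / (k - α) := by
  rw [integral_pow_stableLevy_Ioc hc]
  calc _ ≤ ∫ x in Set.Ioc 0 R, x ^ (k - α - 1) := by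
        refine setIntegral_mono_set (integrableOn_rpow_Ioc (by linarith) hR) ?_
          (Set.Ioc_subset_Ioc_left hc.le).eventuallyLE
        filter_upwards [ae_restrict_mem measurableSet_Ioc] with x hx
        exact Real.rpow_nonneg hx.1.le _
    _ = _ := by
        rw [integral_rpow_Ioc (by linarith) hR, sub_add_cancel]

lemma tendsto_setIntegral_Ioc_left {E : Type*} [NormedAddCommGroup E] [NormedSpace ℝ E]
    {f : ℝ → E} {R : ℝ} (hf : IntegrableOn f (Set.Ioc 0 R)) {c : ℕ → ℝ} (hc : ∀ k, 0 < c k)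
    (hlim : Tendsto c atTop (𝓝 0)) :
    Tendsto (fun k ↦ ∫ x in Set.Ioc (c k) R, f x) atTop (𝓝 (∫ x in Set.Ioc 0 R, f x)) := by
  have h := (aecover_Ioc_of_Ioc (μ := volume) hlim
    (tendsto_const_nhds (x := R))).integral_tendsto_of_countably_generated hf
  refine h.congr fun k ↦ ?_
  rw [Measure.restrict_restrict measurableSet_Ioc,
    Set.inter_eq_left.2 (Set.Ioc_subset_Ioc_left (hc k).le)]

lemma tendsto_integral_id_stableLevy_Ioc (hα : α < 1) {c : ℕ → ℝ} (hc : ∀ k, 0 < c k)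
    (hlim : Tendsto c atTop (𝓝 0)) :
    Tendsto (fun k ↦ ∫ x, x ∂stableLevy α (Set.Ioc (c k) 1)) atTop (𝓝 (1 / (1 - α))) := by
  have h := tendsto_setIntegral_Ioc_left
    (integrableOn_rpow_Ioc (p := 1 - α - 1) (by linarith) zero_le_one) hc hlim
  rw [integral_rpow_Ioc (by linarith) zero_le_one, Real.one_rpow, sub_add_cancel] at h
  refine h.congr fun k ↦ ?_
  simpa using (integral_pow_stableLevy_Ioc (α := α) (R := 1) (hc k) 1).symm

/-- Near `0`, `|e^{itx} - 1| ≤ |t| x` leaves `x^{-α}`, integrable as `α < 1`; at infinity the bound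
`2` suffices as `α > 0`. -/
lemma integrableOn_stableExponent (hα : α ∈ Set.Ioo (0 : ℝ) 1) (t : ℝ) :
    IntegrableOn (fun x : ℝ ↦ (1 / x ^ (α + 1)) • (Complex.exp (Complex.I * t * x) - 1))
      (Set.Ioi 0) := by
  have hmeas : Measurable fun x : ℝ ↦
      (1 / x ^ (α + 1)) • (Complex.exp (Complex.I * t * x) - 1) := by fun_prop
  have hexp (x : ℝ) : Complex.exp (Complex.I * t * x) = Complex.exp (Complex.I * (t * x : ℝ)) := by
    push_cast; ring_nf
  rw [← Set.Ioc_union_Ioi_eq_Ioi zero_le_one]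
  refine IntegrableOn.union ?_ ?_
  · refine ((integrableOn_rpow_Ioc (p := -α) (by linarith [hα.2]) zero_le_one).const_mul
      |t|).mono' hmeas.aestronglyMeasurable ?_
    filter_upwards [ae_restrict_mem measurableSet_Ioc] with x hx
    have hx0 : 0 < x := hx.1
    rw [norm_smul, hexp, Real.norm_of_nonneg (by positivity)]
    calc 1 / x ^ (α + 1) * ‖Complex.exp (Complex.I * (t * x : ℝ)) - 1‖
        ≤ 1 / x ^ (α + 1) * ‖t * x‖ := by gcongr; exact Real.norm_exp_I_mul_ofReal_sub_one_le
      _ = |t| * x ^ (-α) := by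
          rw [norm_mul, Real.norm_eq_abs, Real.norm_of_nonneg hx0.le, Real.rpow_neg hx0.le,
            Real.rpow_add hx0, Real.rpow_one]
          field_simp
  · refine ((integrableOn_Ioi_rpow_of_lt (a := -(α + 1)) (by linarith [hα.1])
      zero_lt_one).const_mul 2).mono' hmeas.aestronglyMeasurable ?_
    filter_upwards [ae_restrict_mem measurableSet_Ioi] with x hx
    have hx0 : 0 < x := zero_lt_one.trans hx
    rw [norm_smul, hexp, Real.norm_of_nonneg (by positivity)]
    calc 1 / x ^ (α + 1) * ‖Complex.exp (Complex.I * (t * x : ℝ)) - 1‖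
        ≤ 1 / x ^ (α + 1) * 2 := by
          gcongr
          refine (norm_sub_le _ _).trans_eq ?_
          rw [Complex.norm_exp_I_mul_ofReal, norm_one]
          norm_num
      _ = 2 * x ^ (-(α + 1)) := by
          rw [Real.rpow_neg hx0.le]
          ring

lemma stableExponent_eq_add (hα : α ∈ Set.Ioo (0 : ℝ) 1) {R : ℝ} (hR : 0 < R) (t : ℝ) :
    stableExponent α t
      = (∫ x in Set.Ioc 0 R, (1 / x ^ (α + 1)) • (Complex.exp (Complex.I * t * x) - 1))
        + ∫ x, (Complex.exp (Complex.I * t * x) - 1) ∂stableLevy α (Set.Ioi R) := by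
  have hint := integrableOn_stableExponent hα t
  rw [integral_stableLevy measurableSet_Ioi (Set.Ioi_subset_Ioi hR.le),
    ← setIntegral_union Set.Ioc_disjoint_Ioi_same measurableSet_Ioi
      (hint.mono_set Set.Ioc_subset_Ioi_self) (hint.mono_set (Set.Ioi_subset_Ioi hR.le)),
    Set.Ioc_union_Ioi_eq_Ioi hR.le, stableExponent]
  refine integral_congr_ae (ae_of_all _ fun x ↦ ?_)
  simp only [Complex.real_smul]
  ring

end StableLevy

/-! ### Weak approximation of the stable law. -/

section Approximation

/-- The truncation level above which the Lévy measure `x^{-α-1} dx` has mass `n`. -/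
noncomputable def jumpCutoff (α : ℝ) (n : ℕ) : ℝ := (α * n) ^ (-(1 / α))

/-- Approximation of the law of the sum of the jumps of size at most `R`. -/
noncomputable def smallJumpLaw (α R : ℝ) (n : ℕ) : Measure ℝ :=
  binomialLaw (stableLevy α (Set.Ioc (jumpCutoff α n) R)) n

/-- Approximation of the law of the sum of the jumps of size larger than `R`. -/
noncomputable def largeJumpLaw (α R : ℝ) (n : ℕ) : Measure ℝ :=
  binomialLaw (stableLevy α (Set.Ioi R)) n

variable {α R : ℝ} {n : ℕ}

lemma natCast_pos_of_inv_le (hα : 0 < α) (hn : 1 / α ≤ n) : 0 < n := by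
  have : (0 : ℝ) < n := (by positivity : 0 < 1 / α).trans_le hn
  exact_mod_cast this

lemma jumpCutoff_pos (hα : 0 < α) (hn : 0 < n) : 0 < jumpCutoff α n := by
  rw [jumpCutoff]; positivity

lemma inv_mul_jumpCutoff_rpow (hα : 0 < α) (hn : 0 < n) :
    1 / (α * jumpCutoff α n ^ α) = n := by
  have : (0 : ℝ) < n := by exact_mod_cast hn
  rw [jumpCutoff, ← Real.rpow_mul (by positivity)]
  have h : -(1 / α) * α = -1 := by field_simp
  rw [h, Real.rpow_neg_one]
  field_simp

lemma tendsto_jumpCutoff (hα : 0 < α) : Tendsto (jumpCutoff α) atTop (𝓝 0) :=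
  (tendsto_rpow_neg_atTop (by positivity : 0 < 1 / α)).comp
    (tendsto_natCast_atTop_atTop.const_mul_atTop hα)

/-- This keeps the weight of the atom at `0` in `thinnedLaw` nonnegative, although the small-jump
mass is unbounded in `n`. -/
lemma stableLevy_small_le (hα : 0 < α) (hn : 0 < n) :
    (stableLevy α (Set.Ioc (jumpCutoff α n) R)).real Set.univ ≤ n := by
  rw [← inv_mul_jumpCutoff_rpow hα hn]
  exact stableLevy_real_univ_le hα (jumpCutoff_pos hα hn) Set.Ioc_subset_Ioi_self

lemma stableLevy_large_le (hα : 0 < α) (hR : 1 ≤ R) (hn : 1 / α ≤ n) :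
    (stableLevy α (Set.Ioi R)).real Set.univ ≤ n := by
  refine (stableLevy_real_univ_le hα (by linarith) subset_rfl).trans (le_trans ?_ hn)
  gcongr
  exact le_mul_of_one_le_right hα.le (Real.one_le_rpow hR hα.le)

lemma isProbabilityMeasure_smallJumpLaw (hα : 0 < α) (hn : 0 < n) :
    IsProbabilityMeasure (smallJumpLaw α R n) := by
  have := isFiniteMeasure_stableLevy (A := Set.Ioc (jumpCutoff α n) R) hα (jumpCutoff_pos hα hn)
    Set.Ioc_subset_Ioi_self
  exact isProbabilityMeasure_binomialLaw hn (stableLevy_small_le hα hn)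

lemma isProbabilityMeasure_largeJumpLaw (hα : 0 < α) (hR : 1 ≤ R) (hn : 1 / α ≤ n) :
    IsProbabilityMeasure (largeJumpLaw α R n) := by
  have := isFiniteMeasure_stableLevy hα (zero_lt_one.trans_le hR) subset_rfl
  exact isProbabilityMeasure_binomialLaw (natCast_pos_of_inv_le hα hn)
    (stableLevy_large_le hα hR hn)

lemma tendsto_charFun_smallJumpLaw_mul (hα : α ∈ Set.Ioo (0 : ℝ) 1) (hR : 1 ≤ R) (t : ℝ) :
    Tendsto (fun n ↦ charFun (smallJumpLaw α R n) t * charFun (largeJumpLaw α R n) t) atTop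
      (𝓝 (Complex.exp (stableExponent α t))) := by
  have hR0 : 0 < R := zero_lt_one.trans_le hR
  have hev : ∀ᶠ n : ℕ in atTop, 1 / α ≤ n := tendsto_natCast_atTop_atTop.eventually_ge_atTop _
  rw [stableExponent_eq_add hα hR0, Complex.exp_add]
  refine Tendsto.mul ?_ ?_
  -- The index is shifted by one because `jumpCutoff α 0 = 0` is not positive.
  · have hint := tendsto_setIntegral_Ioc_left (c := fun k ↦ jumpCutoff α (k + 1))
      ((integrableOn_stableExponent hα t).mono_set (Set.Ioc_subset_Ioi_self : Set.Ioc 0 R ⊆ _))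
      (fun k ↦ jumpCutoff_pos hα.1 k.succ_pos)
      ((tendsto_jumpCutoff hα.1).comp (tendsto_add_atTop_nat 1))
    have hint := (tendsto_add_atTop_iff_nat (f := fun n ↦ ∫ x in Set.Ioc (jumpCutoff α n) R,
      (1 / x ^ (α + 1)) • (Complex.exp (Complex.I * t * x) - 1)) 1).1 hint
    refine (Complex.tendsto_one_add_pow_exp_of_tendsto (g := fun n ↦
      (∫ x in Set.Ioc (jumpCutoff α n) R,
        (1 / x ^ (α + 1)) • (Complex.exp (Complex.I * t * x) - 1)) / n) ?_).congr' ?_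
    · refine hint.congr' ?_
      filter_upwards [eventually_gt_atTop 0] with n hn
      have : (n : ℂ) ≠ 0 := by exact_mod_cast hn.ne'
      field_simp
    · filter_upwards [eventually_gt_atTop 0] with n hn
      have hc := jumpCutoff_pos hα.1 hn
      have := isFiniteMeasure_stableLevy (A := Set.Ioc (jumpCutoff α n) R) hα.1 hc
        Set.Ioc_subset_Ioi_self
      rw [smallJumpLaw, charFun_binomialLaw hn (stableLevy_small_le hα.1 hn),
        integral_stableLevy measurableSet_Ioc fun x hx ↦ hc.trans hx.1]
  · have := isFiniteMeasure_stableLevy hα.1 hR0 subset_rfl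
    refine (Complex.tendsto_one_add_pow_exp_of_tendsto (g := fun n ↦
      (∫ x, (Complex.exp (Complex.I * t * x) - 1) ∂stableLevy α (Set.Ioi R)) / n) ?_).congr' ?_
    · refine tendsto_const_nhds.congr' ?_
      filter_upwards [eventually_gt_atTop 0] with n hn
      have : (n : ℂ) ≠ 0 := by exact_mod_cast hn.ne'
      field_simp
    · filter_upwards [hev] with n hn
      rw [largeJumpLaw, charFun_binomialLaw (natCast_pos_of_inv_le hα.1 hn)
        (stableLevy_large_le hα.1 hR hn)]

/-- The law with characteristic exponent `stableExponent α` is the weak limit of the convolutions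
of the small-jump and the large-jump laws. -/
lemma exists_tendsto_probabilityMeasure (hα : α ∈ Set.Ioo (0 : ℝ) 1) (hR : 1 ≤ R)
    (μ : ProbabilityMeasure ℝ)
    (hμ : ∀ t, charFun (μ : Measure ℝ) t = Complex.exp (stableExponent α t)) :
    ∃ (m : ℕ → ℕ) (μs : ℕ → ProbabilityMeasure ℝ), Tendsto m atTop atTop ∧
      (∀ k, 1 / α ≤ m k) ∧
      (∀ k, (μs k : Measure ℝ) = (smallJumpLaw α R (m k)).conv (largeJumpLaw α R (m k))) ∧
      Tendsto μs atTop (𝓝 μ) := by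
  -- Starting at `⌈1/α⌉₊` makes the large-jump mass at most `n`, so that every law is a probability
  -- measure.
  have hm (k : ℕ) : 1 / α ≤ (k + ⌈1 / α⌉₊ : ℕ) := by
    push_cast
    have := Nat.le_ceil (1 / α)
    have : (0 : ℝ) ≤ k := k.cast_nonneg
    linarith
  have hs (k : ℕ) : IsProbabilityMeasure (smallJumpLaw α R (k + ⌈1 / α⌉₊)) :=
    isProbabilityMeasure_smallJumpLaw hα.1 (natCast_pos_of_inv_le hα.1 (hm k))
  have hl (k : ℕ) : IsProbabilityMeasure (largeJumpLaw α R (k + ⌈1 / α⌉₊)) :=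
    isProbabilityMeasure_largeJumpLaw hα.1 hR (hm k)
  refine ⟨fun k ↦ k + ⌈1 / α⌉₊, fun k ↦ ⟨(smallJumpLaw α R (k + ⌈1 / α⌉₊)).conv
    (largeJumpLaw α R (k + ⌈1 / α⌉₊)), inferInstance⟩, tendsto_add_atTop_nat _, hm,
    fun k ↦ rfl, ?_⟩
  refine ProbabilityMeasure.tendsto_of_tendsto_charFun fun t ↦ ?_
  rw [hμ t]
  refine ((tendsto_charFun_smallJumpLaw_mul hα hR t).comp
    (tendsto_add_atTop_nat ⌈1 / α⌉₊)).congr fun k ↦ ?_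
  exact (charFun_conv t).symm

end Approximation

/-! ### Tail bounds for the approximating laws. -/

section TailBounds

variable {α : ℝ} {n : ℕ}

lemma integral_id_smallJumpLaw {R : ℝ} (hα : 0 < α) (hn : 0 < n) :
    ∫ x, x ∂smallJumpLaw α R n = ∫ x, x ∂stableLevy α (Set.Ioc (jumpCutoff α n) R) := by
  have hc := jumpCutoff_pos hα hn
  have := isFiniteMeasure_stableLevy (A := Set.Ioc (jumpCutoff α n) R) hα hc
    Set.Ioc_subset_Ioi_self
  exact integral_id_binomialLaw hn (stableLevy_small_le hα hn) (memLp_id_stableLevy_Ioc hα hc)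

lemma memLp_smallJumpLaw {R : ℝ} (hα : 0 < α) (hn : 0 < n) :
    MemLp id 2 (smallJumpLaw α R n) := by
  have hc := jumpCutoff_pos hα hn
  have := isFiniteMeasure_stableLevy (A := Set.Ioc (jumpCutoff α n) R) hα hc
    Set.Ioc_subset_Ioi_self
  exact memLp_binomialLaw hn (stableLevy_small_le hα hn) (memLp_id_stableLevy_Ioc hα hc)

lemma variance_smallJumpLaw_le {R : ℝ} (hα : α ∈ Set.Ioo (0 : ℝ) 1) (hn : 0 < n) (hR : 0 ≤ R) :
    Var[id; smallJumpLaw α R n] ≤ R ^ (2 - α) / (2 - α) := by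
  have hc := jumpCutoff_pos hα.1 hn
  have := isFiniteMeasure_stableLevy (A := Set.Ioc (jumpCutoff α n) R) hα.1 hc
    Set.Ioc_subset_Ioi_self
  refine (variance_binomialLaw_le hn (stableLevy_small_le hα.1 hn)
    (memLp_id_stableLevy_Ioc hα.1 hc)).trans ?_
  exact_mod_cast integral_pow_stableLevy_Ioc_le (k := 2) hc hR (by push_cast; linarith [hα.2])

lemma integral_id_smallJumpLaw_le {R : ℝ} (hα : α ∈ Set.Ioo (0 : ℝ) 1) (hn : 0 < n)
    (hR : 0 ≤ R) : ∫ x, x ∂smallJumpLaw α R n ≤ R ^ (1 - α) / (1 - α) := by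
  rw [integral_id_smallJumpLaw hα.1 hn]
  simpa using integral_pow_stableLevy_Ioc_le (α := α) (k := 1) (jumpCutoff_pos hα.1 hn) hR
    (by push_cast; exact hα.2)

/-- The part `∫_1^y x^{-α} dx` of the mean of the small jumps is at most `y`. -/
lemma rpow_one_sub_div_le (hα : α ∈ Set.Ioo (0 : ℝ) 1) {y : ℝ} (hy : 0 ≤ y) :
    y ^ (1 - α) / (1 - α) ≤ 1 / (1 - α) + y := by
  have h1 : 0 < 1 - α := by linarith [hα.2]
  -- Bernoulli's inequality for an exponent in `[0, 1]`.
  have h : y ^ (1 - α) ≤ 1 + (1 - α) * (y - 1) := by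
    have := rpow_one_add_le_one_add_mul_self (s := y - 1) (by linarith) h1.le
      (by linarith [hα.1])
    rwa [add_sub_cancel] at this
  rw [div_add' _ _ _ h1.ne']
  gcongr
  nlinarith

/-- The mean uses up `1/(1-α) + y`, leaving a deviation of `2y` for Chebyshev; the resulting
constant `4(2-α)` exceeds `α`. -/
lemma smallJumpLaw_real_Ioi_le (hα : α ∈ Set.Ioo (0 : ℝ) 1) (hn : 0 < n) {y : ℝ} (hy : 0 < y) :
    (smallJumpLaw α y n).real (Set.Ioi (1 / (1 - α) + 3 * y)) ≤ 1 / (α * y ^ α) := by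
  have := isProbabilityMeasure_smallJumpLaw (R := y) hα.1 hn
  have hmean := (integral_id_smallJumpLaw_le hα hn hy.le).trans (rpow_one_sub_div_le hα hy.le)
  have hcheb := meas_ge_le_variance_div_sq (memLp_smallJumpLaw (R := y) hα.1 hn)
    (by positivity : 0 < 2 * y)
  have hsub : Set.Ioi (1 / (1 - α) + 3 * y)
      ⊆ {x : ℝ | 2 * y ≤ |id x - ∫ x, id x ∂smallJumpLaw α y n|} := by
    intro x hx
    have hx' : 1 / (1 - α) + 3 * y < x := hx
    have habs := le_abs_self (x - ∫ x, x ∂smallJumpLaw α y n)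
    simp only [id, Set.mem_ofPred_eq]
    linarith
  have hvar := variance_smallJumpLaw_le hα hn hy.le
  have h2 : 1 < 2 - α := by linarith [hα.2]
  calc _ ≤ (smallJumpLaw α y n).real _ := measureReal_mono hsub
    _ ≤ Var[id; smallJumpLaw α y n] / (2 * y) ^ 2 :=
        ENNReal.toReal_le_of_le_ofReal (div_nonneg (variance_nonneg _ _) (by positivity)) hcheb
    _ ≤ (y ^ (2 - α) / (2 - α)) / (2 * y) ^ 2 := by gcongr
    _ = 1 / ((2 - α) * 4 * y ^ α) := by
        rw [Real.rpow_sub hy, Real.rpow_two]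
        field_simp
        norm_num
    _ ≤ 1 / (α * y ^ α) := by
        have := hα.1
        gcongr
        linarith [hα.2]

/-- Either the large sum is nonzero, or the small sum alone passes the threshold. -/
lemma conv_real_Ioi_le (hα : α ∈ Set.Ioo (0 : ℝ) 1) (hn : 1 / α ≤ n) {y : ℝ} (hy : 1 ≤ y) :
    ((smallJumpLaw α y n).conv (largeJumpLaw α y n)).real (Set.Ioi (1 / (1 - α) + 3 * y))
      ≤ 2 / (α * y ^ α) := by
  have hn0 := natCast_pos_of_inv_le hα.1 hn
  have hy0 : 0 < y := by linarith
  have := isProbabilityMeasure_smallJumpLaw (R := y) hα.1 hn0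
  have := isProbabilityMeasure_largeJumpLaw hα.1 hy hn
  have := isFiniteMeasure_stableLevy hα.1 hy0 subset_rfl
  have hlarge : (largeJumpLaw α y n).real {0}ᶜ ≤ 1 / (α * y ^ α) :=
    (binomialLaw_real_compl_zero_le hn0 (stableLevy_large_le hα.1 hy hn)).trans_eq
      (stableLevy_real_Ioi_univ hα.1 hy0)
  have hsmall := smallJumpLaw_real_Ioi_le hα hn0 hy0
  rw [Measure.conv, map_measureReal_apply (by fun_prop) measurableSet_Ioi]
  have hsub : (fun x : ℝ × ℝ ↦ x.1 + x.2) ⁻¹' Set.Ioi (1 / (1 - α) + 3 * y)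
      ⊆ Set.Ioi (1 / (1 - α) + 3 * y) ×ˢ Set.univ ∪ Set.univ ×ˢ {0}ᶜ := by
    rintro ⟨u, v⟩ huv
    by_cases hv : v = 0
    · left
      simpa [hv] using huv
    · right
      simpa using hv
  calc _ ≤ _ := measureReal_mono hsub
    _ ≤ _ := measureReal_union_le _ _
    _ ≤ 1 / (α * y ^ α) + 1 / (α * y ^ α) := by
        rw [measureReal_prod_prod, measureReal_prod_prod, probReal_univ, probReal_univ, mul_one,
          one_mul]
        gcongr
    _ = 2 / (α * y ^ α) := by ring

lemma div_one_add_le_largeJumpLaw_real_Ici (hα : 0 < α) (hn : 1 / α ≤ n) {y : ℝ} (hy : 1 ≤ y) :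
    1 / (1 + α * y ^ α) ≤ (largeJumpLaw α 1 n).real (Set.Ici y) := by
  have hy0 : 0 < y := by linarith
  have := isFiniteMeasure_stableLevy hα one_pos subset_rfl
  refine le_trans ?_ (one_sub_exp_le_binomialLaw_real_Ici (natCast_pos_of_inv_le hα hn)
    (stableLevy_large_le hα le_rfl hn)
    (ae_nonneg_stableLevy measurableSet_Ioi (Set.Ioi_subset_Ioi zero_le_one)) hy0)
  set u := (stableLevy α (Set.Ioi 1)).real (Set.Ici y)
  have hu : 1 / (α * y ^ α) ≤ u := le_stableLevy_real_Ici hα one_pos hy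
  set w := α * y ^ α
  have hw : 0 < w := by positivity
  have h1 : Real.exp (-u) ≤ w / (1 + w) := by
    rw [Real.exp_neg, ← inv_div]
    gcongr
    calc (1 + w) / w = 1 / w + 1 := by field_simp
      _ ≤ u + 1 := by gcongr
      _ ≤ Real.exp u := Real.add_one_le_exp u
  have h2 : 1 / (1 + w) = 1 - w / (1 + w) := by field_simp; ring
  linarith

/-- The denominator bounds variance plus squared mean. The numerator keeps the truncated mean, which
reaches `1/(1-α)` only in the limit. -/
lemma sq_sub_div_le_smallJumpLaw_real_Ici (hα : α ∈ Set.Ioo (0 : ℝ) 1) (hn : 0 < n) {a : ℝ}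
    (ha : 0 ≤ a) (ham : a < ∫ x, x ∂stableLevy α (Set.Ioc (jumpCutoff α n) 1)) :
    (∫ x, x ∂stableLevy α (Set.Ioc (jumpCutoff α n) 1) - a) ^ 2
        / (1 / (2 - α) + (1 / (1 - α)) ^ 2)
      ≤ (smallJumpLaw α 1 n).real (Set.Ici a) := by
  have := isProbabilityMeasure_smallJumpLaw (R := 1) hα.1 hn
  have h1 : 0 < 1 - α := by linarith [hα.2]
  have h2 : 0 < 2 - α := by linarith
  have hc := jumpCutoff_pos hα.1 hn
  have hmem := memLp_smallJumpLaw (R := 1) hα.1 hn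
  have := isFiniteMeasure_stableLevy (A := Set.Ioc (jumpCutoff α n) 1) hα.1 hc
    Set.Ioc_subset_Ioi_self
  have hmean := integral_id_smallJumpLaw_le hα hn zero_le_one
  have hvar := variance_smallJumpLaw_le hα hn zero_le_one
  rw [Real.one_rpow] at hmean hvar
  rw [← integral_id_smallJumpLaw hα.1 hn] at ham ⊢
  refine sq_sub_div_le_measureReal_Ici hmem
    (ae_nonneg_binomialLaw hn (stableLevy_small_le hα.1 hn)
      (ae_nonneg_stableLevy measurableSet_Ioc fun x hx ↦ hc.trans hx.1)) ha ham ?_ (by positivity)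
  have hv := variance_eq_sub hmem
  simp only [id, Pi.pow_apply] at hv
  have : (∫ x, x ∂smallJumpLaw α 1 n) ^ 2 ≤ (1 / (1 - α)) ^ 2 :=
    pow_le_pow_left₀ (ha.trans ham.le) hmean 2
  linarith

lemma mul_le_conv_real_Ici {μ ν : Measure ℝ} [IsFiniteMeasure μ] [IsFiniteMeasure ν] (a b : ℝ) :
    μ.real (Set.Ici a) * ν.real (Set.Ici b) ≤ (μ.conv ν).real (Set.Ici (a + b)) := by
  rw [Measure.conv, map_measureReal_apply (by fun_prop) measurableSet_Ici, ← measureReal_prod_prod]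
  refine measureReal_mono ?_
  rintro ⟨u, v⟩ ⟨hu, hv⟩
  exact add_le_add (Set.mem_Ici.1 hu) (Set.mem_Ici.1 hv)

lemma two_thirds_mul_sq_le (hα : α ∈ Set.Ioo (0 : ℝ) 1) (θ : ℝ) :
    2 / 3 * (1 - θ) ^ 2
      ≤ (1 / (1 - α) - θ / (1 - α)) ^ 2 / (1 / (2 - α) + (1 / (1 - α)) ^ 2) := by
  have h1 : 0 < 1 - α := by linarith [hα.2]
  have h2 : 0 < 2 - α := by linarith
  rw [le_div_iff₀ (by positivity)]
  have h3 : (1 / (1 - α) - θ / (1 - α)) ^ 2 = (1 - θ) ^ 2 * (1 / (1 - α)) ^ 2 := by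
    field_simp
  -- Equivalent to `2α² ≤ 3α`. The denominator is then at most `3/2 · (1-α)^{-2}`, the source of the
  -- constant `2/3`.
  have h4 : 1 / (2 - α) ≤ 1 / 2 * (1 / (1 - α)) ^ 2 := by
    rw [div_pow, one_pow, ← mul_div_assoc, div_le_div_iff₀ h2 (by positivity)]
    nlinarith [hα.1, hα.2]
  rw [h3]
  nlinarith [mul_le_mul_of_nonneg_left h4 (sq_nonneg (1 - θ))]

end TailBounds

theorem theorem6 {Ω : Type*} [MeasurableSpace Ω] (P : Measure Ω) [IsProbabilityMeasure P]
    (α : ℝ) (hα : α ∈ Set.Ioo (0 : ℝ) 1) (X : Ω → ℝ)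
    (hX : IsTotallyAsymmetricStable α X P) :
    (∀ y : ℝ, (1 / α) ^ (1 / α) ≤ y →
      P.real {ω | X ω > 1 / (1 - α) + 3 * y} ≤ 2 / (α * y ^ α)) ∧
    (∀ y θ : ℝ, 1 ≤ y → θ ∈ Set.Ioo (0 : ℝ) 1 →
      P.real {ω | X ω ≥ θ / (1 - α) + y} ≥
        2 / 3 * (1 - θ) ^ 2 * (1 / (1 + α * y ^ α))) := by
  have h0 := hα.1
  have h1 : 0 < 1 - α := by linarith [hα.2]
  let μ : ProbabilityMeasure ℝ := ⟨P.map X, Measure.isProbabilityMeasure_map hX.aemeasurable⟩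
  have hμ (s : Set ℝ) (hs : MeasurableSet s) : P.real (X ⁻¹' s) = (μ : Measure ℝ).real s := by
    simp only [measureReal_def]
    exact congrArg _ (Measure.map_apply_of_aemeasurable hX.aemeasurable hs).symm
  refine ⟨fun y hy ↦ ?_, fun y θ hy hθ ↦ ?_⟩
  · have hy1 : 1 ≤ y := by
      refine le_trans (Real.one_le_rpow ?_ (by positivity)) hy
      rw [le_div_iff₀ h0]
      linarith [hα.2]
    have hy0 : 0 < y := by linarith
    obtain ⟨m, μs, -, hmα, hμs, hlim⟩ :=
      exists_tendsto_probabilityMeasure hα hy1 μ hX.charFun_eq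
    refine (hμ _ measurableSet_Ioi).trans_le ?_
    refine ENNReal.toReal_le_of_le_ofReal (by positivity)
      ((ProbabilityMeasure.le_liminf_measure_open_of_tendsto hlim isOpen_Ioi).trans ?_)
    -- An eventual lower bound `b` holds at some `k`, where the uniform tail bound applies.
    refine liminf_le_of_le (by isBoundedDefault) fun b hb ↦ ?_
    obtain ⟨k, hk⟩ := hb.exists
    refine hk.trans ?_
    rw [← ofReal_measureReal, hμs k]
    exact ENNReal.ofReal_le_ofReal (conv_real_Ioi_le hα (hmα k) hy1)
  · obtain ⟨m, μs, hm, hmα, hμs, hlim⟩ :=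
      exists_tendsto_probabilityMeasure hα le_rfl μ hX.charFun_eq
    have hpos (k : ℕ) : 0 < m k := natCast_pos_of_inv_le h0 (hmα k)
    refine ((hμ _ measurableSet_Ici).trans_ge ?_)
    set a := θ / (1 - α) with ha
    have ha0 : 0 ≤ a := div_nonneg hθ.1.le h1.le
    let M : ℕ → ℝ := fun k ↦ ∫ x, x ∂stableLevy α (Set.Ioc (jumpCutoff α (m k)) 1)
    have hM : Tendsto M atTop (𝓝 (1 / (1 - α))) :=
      tendsto_integral_id_stableLevy_Ioc hα.2 (fun k ↦ jumpCutoff_pos h0 (hpos k))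
        ((tendsto_jumpCutoff h0).comp hm)
    have haM : ∀ᶠ k in atTop, a < M k := by
      refine hM.eventually_const_lt ?_
      rw [ha]
      gcongr
      exact hθ.2
    let g : ℕ → ℝ := fun k ↦
      (M k - a) ^ 2 / (1 / (2 - α) + (1 / (1 - α)) ^ 2) * (1 / (1 + α * y ^ α))
    have hg : Tendsto g atTop (𝓝 ((1 / (1 - α) - a) ^ 2 / (1 / (2 - α) + (1 / (1 - α)) ^ 2)
        * (1 / (1 + α * y ^ α)))) :=
      (((hM.sub_const a).pow 2).div_const _).mul_const _
    have hle : ∀ᶠ k in atTop, ENNReal.ofReal (g k) ≤ (μs k : Measure ℝ) (Set.Ici (a + y)) := by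
      filter_upwards [haM] with k hk
      have := isProbabilityMeasure_smallJumpLaw (R := 1) h0 (hpos k)
      have := isProbabilityMeasure_largeJumpLaw h0 le_rfl (hmα k)
      rw [← ofReal_measureReal, hμs k]
      refine ENNReal.ofReal_le_ofReal (le_trans ?_ (mul_le_conv_real_Ici a y))
      exact mul_le_mul (sq_sub_div_le_smallJumpLaw_real_Ici hα (hpos k) ha0 hk)
        (div_one_add_le_largeJumpLaw_real_Ici h0 (hmα k) hy)
        (by positivity) measureReal_nonneg
    -- The lower bound needs the closed-set half of portmanteau, hence the closed half-line.
    have hlimsup := ProbabilityMeasure.limsup_measure_closed_le_of_tendsto hlim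
      (isClosed_Ici (a := a + y))
    have hfin : ENNReal.ofReal ((1 / (1 - α) - a) ^ 2 / (1 / (2 - α) + (1 / (1 - α)) ^ 2)
        * (1 / (1 + α * y ^ α))) ≤ (μ : Measure ℝ) (Set.Ici (a + y)) := by
      rw [← (ENNReal.tendsto_ofReal hg).limsup_eq]
      exact (limsup_le_limsup hle).trans hlimsup
    have hfin := (ENNReal.ofReal_le_iff_le_toReal (measure_ne_top _ _)).1 hfin
    refine le_trans ?_ hfin
    gcongr
    exact two_thirds_mul_sq_le hα θ
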